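/- Consider the linear regression model $Y = X\theta + \sigma\xi$, where $\theta\in\mathbb R^p$ is unknown, $\sigma>0$, $\xi\sim\mathcal N(0,I_n)$, and $X$ is a random real $n\times p$ matrix independent of $\xi$. Let $\mathbf P_\theta$ denote the joint distribution of $(X,Y)$. For $s\in\{1,\dots,p\}$ and $\tau>0$ put $\Theta(s,\tau)=\{\theta\in\mathbb R^p : \|\theta\|_0\le s,\ \|\theta\|_2\ge\tau\}$, where $\|\theta\|_0$ is the number of nonzero coordinates of $\theta$, and define the minimax testing risk $$\mathcal R_{s,\tau}=\inf_{\Delta}\Big\{\mathbf P_0(\Delta=1)+\sup_{\theta\in\Theta(s,\tau)}\mathbf P_\theta(\Delta=0)\Big\},$$ where the infimum is over all $\{0,1\}$-valued statistics $\Delta=\Delta(X,Y)$. A random vector $\eta$ in $\mathbb R^d$ is called $b$-subgaussian if $\mathbf E\exp(t\langle\eta,v\rangle)\le\exp(b^2t^2/2)$ for all $t\in\mathbb R$ and all $v\in\mathbb R^d$ with $\|v\|_2=1$. The distribution of $X$ is called isotropic if $\mathbf E(X^TX/n)=I_p$. **Theorem.** For every $\varepsilon\in(0,1)$ and $\sigma_X>0$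 there exists $a_\varepsilon>0$, depending only on $\varepsilon$ and $\sigma_X$, such that the following holds. Let $n\ge1$ and $1\le s\le p$ be integers, let $\sigma>0$, and let the distribution of $X$ be isotropic, with independent $\sigma_X$-subgaussian rows. Then for every $A$ with $0<A<a_\varepsilon$ and $$\tau=A\sigma\min\Big(\sqrt{\frac{s\log(2+p/s^2)}{n}},\ n^{-1/4},\ \frac{p^{1/4}}{\sqrt n}\Big)$$ we have $\mathcal R_{s,\tau}\ge 1-\varepsilon$. -/

import Mathlib

open MeasureTheory ProbabilityTheory
open scoped ENNReal

noncomputable section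

namespace SparseTesting

/-- The Borel (product) measurable structure on real `n × p` matrices. -/
instance matrixMeasurableSpace (n p : ℕ) : MeasurableSpace (Matrix (Fin n) (Fin p) ℝ) :=
  inferInstanceAs (MeasurableSpace (Fin n → Fin p → ℝ))

/-- The number of nonzero coordinates of a vector. -/
def l0Norm {p : ℕ} (u : EuclideanSpace ℝ (Fin p)) : ℕ :=
  (Finset.univ.filter fun j : Fin p => u j ≠ 0).card

/-- The alternative: `s`-sparse vectors in `ℝ^p` of Euclidean norm at least `τ`. -/
def Alternative (p s : ℕ) (τ : ℝ) : Set (EuclideanSpace ℝ (Fin p)) :=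
  {θ | l0Norm θ ≤ s ∧ τ ≤ ‖θ‖}

/-- A random vector is `b`-subgaussian if for every unit vector `v` the variable `⟨η, v⟩`
satisfies `E exp (t ⟨η, v⟩) ≤ exp (b² t² / 2)` for all real `t`
(finiteness of the exponential moments is part of Mathlib's `HasSubgaussianMGF`). -/
def IsSubgaussianVector {Ω : Type*} [MeasurableSpace Ω] {d : ℕ} (b : ℝ)
    (η : Ω → EuclideanSpace ℝ (Fin d)) (μ : Measure Ω) : Prop :=
  ∀ v : EuclideanSpace ℝ (Fin d), ‖v‖ = 1 →
    HasSubgaussianMGF (fun ω => inner ℝ (η ω) v) (Real.toNNReal (b ^ 2)) μ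

/-- The `i`-th row of a matrix, as a vector of Euclidean space. -/
def rowVec {n p : ℕ} (i : Fin n) (X : Matrix (Fin n) (Fin p) ℝ) : EuclideanSpace ℝ (Fin p) :=
  WithLp.toLp 2 (X i)

/-- The distribution `PX` of a random `n × p` matrix is isotropic if `E (Xᵀ X / n) = I_p`
(the expectation is taken entrywise). -/
def IsIsotropic {n p : ℕ} (PX : Measure (Matrix (Fin n) (Fin p) ℝ)) : Prop :=
  ∀ j k : Fin p,
    Integrable (fun X : Matrix (Fin n) (Fin p) ℝ => (X.transpose * X) j k / (n : ℝ)) PX ∧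
      ∫ X : Matrix (Fin n) (Fin p) ℝ, (X.transpose * X) j k / (n : ℝ) ∂PX = (1 : Matrix (Fin p) (Fin p) ℝ) j k

/-- A random matrix with distribution `PX` has (mutually) independent `b`-subgaussian rows. -/
def HasIndepSubgaussianRows {n p : ℕ} (b : ℝ)
    (PX : Measure (Matrix (Fin n) (Fin p) ℝ)) : Prop :=
  iIndepFun (fun i : Fin n => rowVec (p := p) i) PX ∧
    ∀ i : Fin n, IsSubgaussianVector b (rowVec (p := p) i) PX

/-- The standard Gaussian distribution `N(0, I_n)` on `ℝ^n`. -/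
def whiteNoise (n : ℕ) : Measure (Fin n → ℝ) :=
  Measure.pi fun _ => gaussianReal 0 1

/-- The joint distribution of `(X, Y)` where `Y = X θ + σ ξ`, with `X` distributed according
to `PX`, `ξ` standard Gaussian, and `X` independent of `ξ`. -/
def jointLaw {n p : ℕ} (PX : Measure (Matrix (Fin n) (Fin p) ℝ)) (σ : ℝ)
    (θ : EuclideanSpace ℝ (Fin p)) : Measure (Matrix (Fin n) (Fin p) ℝ × (Fin n → ℝ)) :=
  (PX.prod (whiteNoise n)).map fun z => (z.1, z.1.mulVec (fun j => θ j) + σ • z.2)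

/-- The risk of the test `Δ` of `θ = 0` against the alternative: the probability of type I
error plus the supremum over the alternative of the probability of type II error. -/
def testRisk {n p : ℕ} (PX : Measure (Matrix (Fin n) (Fin p) ℝ)) (σ : ℝ) (s : ℕ) (τ : ℝ)
    (Δ : Matrix (Fin n) (Fin p) ℝ × (Fin n → ℝ) → Fin 2) : ℝ≥0∞ :=
  jointLaw PX σ 0 {z | Δ z = 1} + ⨆ θ ∈ Alternative p s τ, jointLaw PX σ θ {z | Δ z = 0}

/-- The minimax risk: the infimum of the risk over all (measurable) `{0, 1}`-valued
statistics of `(X, Y)`. -/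
def minimaxRisk {n p : ℕ} (PX : Measure (Matrix (Fin n) (Fin p) ℝ)) (σ : ℝ) (s : ℕ)
    (τ : ℝ) : ℝ≥0∞ :=
  ⨅ (Δ : Matrix (Fin n) (Fin p) ℝ × (Fin n → ℝ) → Fin 2) (_ : Measurable Δ),
    testRisk PX σ s τ Δ

end SparseTesting

end

namespace SparseTesting

/-! Ingster's second-moment method. Draw `θ` uniformly from a finite set of `s`-sparse vectors of
norm `τ`, and let `L` be the likelihood ratio of the mixture against the null. If `E L² ≤ 1 + ε²`,
no test has risk below `1 - ε` (`le_minimaxRisk_of_second_moment`). Gaussian integration turns `E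
L²` into the average over pairs `θ = τu`, `θ' = τv` of `E exp(δ ∑ᵢ ⟨xᵢ,u⟩⟨xᵢ,v⟩)`, where `δ =
(τ/σ)²` and the `xᵢ` are the rows of `X`.

The rows are independent, the products are subexponential and isotropy makes the total mean
`n⟨u,v⟩`, so this moment is at most `exp(δn⟨u,v⟩ + Cnδ²)` (`integral_exp_sum_inner_rowVec_mul_le`).
The `n^(-1/4)` term of the rate controls `nδ²`.

For the overlap `⟨u,v⟩`, the prior puts one random sign at a random place in each of `s` disjoint
blocks of size `m = ⌊p/s⌋`. The overlap is then a sum of independent block terms, and its Laplace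
transform is at most `exp(s(cosh t - 1)/m)` with `t = nδ/s`. The other two terms of the rate bound
this exponent by `4A²` (`mul_cosh_sub_one_div_le`). -/

instance isProbabilityMeasure_whiteNoise (n : ℕ) : IsProbabilityMeasure (whiteNoise n) := by
  unfold whiteNoise; infer_instance

/-! ### Gaussian shifts and their likelihood ratios -/

/-- The likelihood ratio of `N(m, I_n)` with respect to `N(0, I_n)`. -/
noncomputable def shiftDensity {n : ℕ} (m x : Fin n → ℝ) : ℝ := Real.exp (m ⬝ᵥ x - m ⬝ᵥ m / 2)

lemma shiftDensity_eq_prod {n : ℕ} (m x : Fin n → ℝ) :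
    shiftDensity m x = ∏ i, Real.exp (m i * x i - m i ^ 2 / 2) := by
  rw [shiftDensity, ← Real.exp_sum, Finset.sum_sub_distrib, ← Finset.sum_div]
  simp [dotProduct, sq]

lemma shiftDensity_pos {n : ℕ} (m x : Fin n → ℝ) : 0 < shiftDensity m x := Real.exp_pos _

lemma measurable_shiftDensity {n : ℕ} :
    Measurable fun z : (Fin n → ℝ) × (Fin n → ℝ) => shiftDensity z.1 z.2 := by
  unfold shiftDensity dotProduct
  fun_prop

lemma shiftDensity_mul_add {n : ℕ} (m l x : Fin n → ℝ) :
    shiftDensity l (m + x) = Real.exp (m ⬝ᵥ l) * shiftDensity l x := by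
  rw [shiftDensity, shiftDensity, ← Real.exp_add, dotProduct_add, dotProduct_comm l m]
  congr 1; ring

lemma gaussianReal_eq_withDensity (m : ℝ) :
    gaussianReal m 1 = (gaussianReal 0 1).withDensity
      fun x => ENNReal.ofReal (Real.exp (m * x - m ^ 2 / 2)) := by
  rw [gaussianReal_of_var_ne_zero _ one_ne_zero, gaussianReal_of_var_ne_zero _ one_ne_zero,
    ← withDensity_mul _ (measurable_gaussianPDF _ _) (by fun_prop)]
  congr 1
  ext x
  simp only [Pi.mul_apply, gaussianPDF]
  rw [← ENNReal.ofReal_mul (gaussianPDFReal_nonneg _ _ _)]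
  congr 1
  rw [gaussianPDFReal, gaussianPDFReal, mul_assoc _ (Real.exp _) (Real.exp _), ← Real.exp_add]
  congr 2
  simp only [NNReal.coe_one]; ring

lemma whiteNoise_map_add {n : ℕ} (m : Fin n → ℝ) :
    (whiteNoise n).map (fun x => m + x) =
      (whiteNoise n).withDensity fun x => ENNReal.ofReal (shiftDensity m x) := by
  have h1 : (whiteNoise n).map (fun x => m + x) = Measure.pi fun i => gaussianReal (m i) 1 := by
    unfold whiteNoise
    have := Measure.pi_map_pi (μ := fun _ : Fin n => gaussianReal 0 1)
      (f := fun i x => m i + x) (hμ := fun i => by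
        rw [gaussianReal_map_const_add]; infer_instance) (fun i => by fun_prop)
    simp only [gaussianReal_map_const_add, zero_add] at this
    exact this
  rw [h1]
  refine Measure.pi_eq fun S hS => ?_
  rw [withDensity_apply _ (MeasurableSet.univ_pi hS), ← lintegral_indicator (MeasurableSet.univ_pi hS)]
  have h2 : ∀ x : Fin n → ℝ, (Set.univ.pi S).indicator
      (fun x => ENNReal.ofReal (shiftDensity m x)) x =
      ∏ i, (S i).indicator (fun y => ENNReal.ofReal (Real.exp (m i * y - m i ^ 2 / 2))) (x i) := by
    intro x
    by_cases hx : x ∈ Set.univ.pi S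
    · rw [Set.indicator_of_mem hx, shiftDensity_eq_prod,
        ENNReal.ofReal_prod_of_nonneg fun i _ => (Real.exp_pos _).le]
      exact Finset.prod_congr rfl fun i _ => (Set.indicator_of_mem (hx i trivial)
        fun y => ENNReal.ofReal (Real.exp (m i * y - m i ^ 2 / 2))).symm
    · rw [Set.indicator_of_notMem hx]
      simp only [Set.mem_univ_pi, not_forall] at hx
      obtain ⟨i, hi⟩ := hx
      exact (Finset.prod_eq_zero (Finset.mem_univ i) (Set.indicator_of_notMem hi _)).symm
  simp_rw [h2]
  have h3 : ∀ i, Measurable ((S i).indicator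
      (fun y => ENNReal.ofReal (Real.exp (m i * y - m i ^ 2 / 2)))) :=
    fun i => Measurable.indicator (by fun_prop) (hS i)
  have hind : iIndepFun (fun i (x : Fin n → ℝ) => (S i).indicator
      (fun y => ENNReal.ofReal (Real.exp (m i * y - m i ^ 2 / 2))) (x i)) (whiteNoise n) :=
    iIndepFun_pi (X := fun i => (S i).indicator
      (fun y => ENNReal.ofReal (Real.exp (m i * y - m i ^ 2 / 2))))
      (fun i => (h3 i).aemeasurable)
  rw [lintegral_prod_eq_prod_lintegral_of_indepFun _ _ hind
    (fun i => (h3 i).comp (measurable_pi_apply i))]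
  refine Finset.prod_congr rfl fun i _ => ?_
  rw [whiteNoise, (measurePreserving_eval (fun _ : Fin n => gaussianReal 0 1) i).lintegral_comp
    (h3 i), lintegral_indicator (hS i), gaussianReal_eq_withDensity (m i),
    withDensity_apply _ (hS i)]

/-- Cameron–Martin as a change of variables; the first and second moments of the likelihood ratios
and the formula for `jointLaw` all come from it. -/
lemma lintegral_shiftDensity_mul {n : ℕ} (m : Fin n → ℝ) {F : (Fin n → ℝ) → ℝ≥0∞}
    (hF : Measurable F) :
    ∫⁻ x, ENNReal.ofReal (shiftDensity m x) * F x ∂whiteNoise n =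
      ∫⁻ x, F (m + x) ∂whiteNoise n := by
  have hm : Measurable fun x => ENNReal.ofReal (shiftDensity m x) :=
    ENNReal.measurable_ofReal.comp (measurable_shiftDensity.comp (by fun_prop :
      Measurable fun x : Fin n → ℝ => (m, x)))
  rw [← lintegral_map hF (by fun_prop : Measurable fun x => m + x), whiteNoise_map_add,
    lintegral_withDensity_eq_lintegral_mul _ hm hF]
  rfl

lemma lintegral_shiftDensity {n : ℕ} (m : Fin n → ℝ) :
    ∫⁻ x, ENNReal.ofReal (shiftDensity m x) ∂whiteNoise n = 1 := by
  simpa using lintegral_shiftDensity_mul m (F := 1) measurable_one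

lemma lintegral_shiftDensity_mul_shiftDensity {n : ℕ} (m l : Fin n → ℝ) :
    ∫⁻ x, ENNReal.ofReal (shiftDensity m x * shiftDensity l x) ∂whiteNoise n =
      ENNReal.ofReal (Real.exp (m ⬝ᵥ l)) := by
  have hl : Measurable fun x => ENNReal.ofReal (shiftDensity l x) :=
    ENNReal.measurable_ofReal.comp (measurable_shiftDensity.comp (by fun_prop :
      Measurable fun x : Fin n → ℝ => (l, x)))
  simp_rw [ENNReal.ofReal_mul (shiftDensity_pos m _).le]
  rw [lintegral_shiftDensity_mul m hl]
  simp_rw [shiftDensity_mul_add, ENNReal.ofReal_mul (Real.exp_pos (m ⬝ᵥ l)).le]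
  rw [lintegral_const_mul _ hl, lintegral_shiftDensity, mul_one]

/-! ### From the testing risk to a second moment -/

/-- If the likelihood ratio `L` has second moment at most `1 + ε²`, then the sum of the errors of
any test is at least `1 - ε`. -/
lemma one_sub_le_of_integral_sq_le {Ω : Type*} [MeasurableSpace Ω] {Q : Measure Ω}
    [IsProbabilityMeasure Q] {L : Ω → ℝ} {ε : ℝ} (hε : 0 < ε) (hL : Integrable L Q)
    (hL2 : Integrable (fun ω => L ω ^ 2) Q) (h1 : ∫ ω, L ω ∂Q = 1)
    (h2 : ∫ ω, L ω ^ 2 ∂Q ≤ 1 + ε ^ 2) {E : Set Ω} (hE : MeasurableSet E) :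
    1 - ε ≤ Q.real Eᶜ + ∫ ω in E, L ω ∂Q := by
  -- The majorant is `ε/2 + (1 - L)²/(2ε)`, which dominates `1 - L` by AM–GM; its integral is at
  -- most `ε` because `∫ (1 - L)² ≤ ε²`.
  have hR : Integrable (fun ω => ε / 2 + (1 / (2 * ε)) * (1 - 2 * L ω + L ω ^ 2)) Q := by
    fun_prop
  have hRi : ∫ ω, (ε / 2 + (1 / (2 * ε)) * (1 - 2 * L ω + L ω ^ 2)) ∂Q ≤ ε := by
    rw [integral_add (by fun_prop) (by fun_prop), integral_const_mul,
      integral_add (by fun_prop) (by fun_prop), integral_sub (by fun_prop) (by fun_prop),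
      integral_const_mul, h1]
    simp only [integral_const, probReal_univ, smul_eq_mul, one_mul, mul_one]
    have : 1 / (2 * ε) * (1 - 2 + ∫ ω, L ω ^ 2 ∂Q) ≤ 1 / (2 * ε) * ε ^ 2 := by
      gcongr; linarith
    have h3 : 1 / (2 * ε) * ε ^ 2 = ε / 2 := by field_simp
    linarith
  have hpt : ∀ ω, 1 - L ω ≤ ε / 2 + (1 / (2 * ε)) * (1 - 2 * L ω + L ω ^ 2) := by
    intro ω
    have : ε / 2 + (1 / (2 * ε)) * (1 - 2 * L ω + L ω ^ 2) - (1 - L ω) =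
        (1 / (2 * ε)) * (1 - L ω - ε) ^ 2 := by
      field_simp; ring
    have h0 : 0 ≤ (1 / (2 * ε)) * (1 - L ω - ε) ^ 2 := by positivity
    linarith
  have hR0 : ∀ ω, 0 ≤ ε / 2 + (1 / (2 * ε)) * (1 - 2 * L ω + L ω ^ 2) := by
    intro ω
    have : 1 - 2 * L ω + L ω ^ 2 = (1 - L ω) ^ 2 := by ring
    rw [this]; positivity
  have h4 : ∫ ω in E, (1 - L ω) ∂Q ≤ ε :=
    ((setIntegral_mono ((integrable_const 1).sub hL).integrableOn hR.integrableOn hpt).trans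
      (setIntegral_le_integral hR (ae_of_all _ hR0))).trans hRi
  rw [integral_sub (by fun_prop) hL.integrableOn] at h4
  have h5 := probReal_compl_eq_one_sub (μ := Q) hE
  simp only [integral_const, smul_eq_mul, mul_one, measureReal_restrict_apply_univ] at h4
  linarith

variable {n p : ℕ}

/-- The mean of the normalized observations, conditionally on the design. -/
noncomputable def scaledMean (σ : ℝ) (θ : EuclideanSpace ℝ (Fin p)) (X : Matrix (Fin n) (Fin p) ℝ) :
    Fin n → ℝ := σ⁻¹ • X.mulVec (fun j => θ j)

lemma measurable_entry (i : Fin n) (j : Fin p) :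
    Measurable fun X : Matrix (Fin n) (Fin p) ℝ => X i j :=
  (measurable_pi_apply j).comp (measurable_pi_apply (X := fun _ : Fin n => Fin p → ℝ) i)

lemma measurable_scaledMean (σ : ℝ) (θ : EuclideanSpace ℝ (Fin p)) :
    Measurable (scaledMean (n := n) σ θ) := by
  refine measurable_pi_lambda _ fun i => ?_
  simp only [scaledMean, Pi.smul_apply, Matrix.mulVec, dotProduct]
  have : Measurable fun X : Matrix (Fin n) (Fin p) ℝ => ∑ j, X i j * θ j :=
    Finset.measurable_sum _ fun j _ => (measurable_entry i j).mul_const _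
  exact this.const_mul σ⁻¹

/-- The likelihood ratio of the laws of `(X, Y)` under `θ` and `0`, in terms of the design and
the normalized observations. -/
noncomputable def likelihoodRatio (σ : ℝ) (θ : EuclideanSpace ℝ (Fin p))
    (z : Matrix (Fin n) (Fin p) ℝ × (Fin n → ℝ)) : ℝ :=
  shiftDensity (scaledMean σ θ z.1) z.2

lemma measurable_likelihoodRatio (σ : ℝ) (θ : EuclideanSpace ℝ (Fin p)) :
    Measurable (likelihoodRatio (n := n) σ θ) :=
  measurable_shiftDensity.comp
    (((measurable_scaledMean σ θ).comp measurable_fst).prodMk measurable_snd)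

lemma likelihoodRatio_pos (σ : ℝ) (θ : EuclideanSpace ℝ (Fin p))
    (z : Matrix (Fin n) (Fin p) ℝ × (Fin n → ℝ)) : 0 < likelihoodRatio σ θ z :=
  shiftDensity_pos _ _

lemma likelihoodRatio_zero (σ : ℝ) (z : Matrix (Fin n) (Fin p) ℝ × (Fin n → ℝ)) :
    likelihoodRatio σ 0 z = 1 := by
  have : (fun _ => 0 : Fin p → ℝ) = 0 := rfl
  simp [likelihoodRatio, shiftDensity, scaledMean, this]

lemma measurable_scale (σ : ℝ) : Measurable
    fun z : Matrix (Fin n) (Fin p) ℝ × (Fin n → ℝ) => (z.1, σ • z.2) :=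
  measurable_fst.prodMk (Measurable.const_smul (g := fun z : Matrix (Fin n) (Fin p) ℝ ×
    (Fin n → ℝ) => z.2) measurable_snd σ)

/-- Given `X`, the vector `Y/σ` is Gaussian with mean `scaledMean σ θ X` and identity covariance.
After this rescaling all `θ` share one reference measure, so mixtures over `θ` become averages of
densities. -/
lemma jointLaw_apply (PX : Measure (Matrix (Fin n) (Fin p) ℝ)) [IsProbabilityMeasure PX]
    {σ : ℝ} (hσ : 0 < σ) (θ : EuclideanSpace ℝ (Fin p))
    {B : Set (Matrix (Fin n) (Fin p) ℝ × (Fin n → ℝ))} (hB : MeasurableSet B) :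
    jointLaw PX σ θ B = ∫⁻ z in (fun z => (z.1, σ • z.2)) ⁻¹' B,
      ENNReal.ofReal (likelihoodRatio σ θ z) ∂PX.prod (whiteNoise n) := by
  have hE : MeasurableSet ((fun z : Matrix (Fin n) (Fin p) ℝ × (Fin n → ℝ) =>
    (z.1, σ • z.2)) ⁻¹' B) := measurable_scale σ hB
  have hmean : Measurable fun X : Matrix (Fin n) (Fin p) ℝ => X.mulVec (fun j => θ j) := by
    refine measurable_pi_lambda _ fun i => ?_
    simp only [Matrix.mulVec, dotProduct]
    exact Finset.measurable_sum _ fun j _ => (measurable_entry i j).mul_const _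
  have hmap : Measurable fun z : Matrix (Fin n) (Fin p) ℝ × (Fin n → ℝ) =>
      (z.1, z.1.mulVec (fun j => θ j) + σ • z.2) :=
    measurable_fst.prodMk ((hmean.comp measurable_fst).add (Measurable.const_smul
      (g := fun z : Matrix (Fin n) (Fin p) ℝ × (Fin n → ℝ) => z.2) measurable_snd σ))
  have hLm : Measurable fun z : Matrix (Fin n) (Fin p) ℝ × (Fin n → ℝ) =>
      ENNReal.ofReal (likelihoodRatio σ θ z) :=
    ENNReal.measurable_ofReal.comp (measurable_likelihoodRatio (n := n) σ θ)
  rw [jointLaw, Measure.map_apply hmap hB, ← lintegral_indicator hE,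
    ← lintegral_indicator_one (hmap hB),
    lintegral_prod _ ((measurable_one.indicator (hmap hB)).aemeasurable),
    lintegral_prod _ (hLm.indicator hE).aemeasurable]
  refine lintegral_congr fun X => ?_
  have hF : Measurable fun x : Fin n → ℝ =>
      ((fun z : Matrix (Fin n) (Fin p) ℝ × (Fin n → ℝ) => (z.1, σ • z.2)) ⁻¹' B).indicator
        (1 : Matrix (Fin n) (Fin p) ℝ × (Fin n → ℝ) → ℝ≥0∞) (X, x) :=
    (measurable_one.indicator hE).comp measurable_prodMk_left
  have := lintegral_shiftDensity_mul (scaledMean σ θ X) hF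
  convert this.symm using 2
  · ext x
    have h : σ • (scaledMean σ θ X + x) = X.mulVec (fun j => θ j) + σ • x := by
      rw [scaledMean, smul_add, smul_smul, mul_inv_cancel₀ hσ.ne', one_smul]
    have hmem : (X, scaledMean σ θ X + x) ∈ (fun z : Matrix (Fin n) (Fin p) ℝ × (Fin n → ℝ) =>
          (z.1, σ • z.2)) ⁻¹' B ↔
        (X, x) ∈ (fun z : Matrix (Fin n) (Fin p) ℝ × (Fin n → ℝ) =>
          (z.1, z.1.mulVec (fun j => θ j) + σ • z.2)) ⁻¹' B := by
      change (X, σ • (scaledMean σ θ X + x)) ∈ B ↔ (X, X.mulVec (fun j => θ j) + σ • x) ∈ B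
      rw [h]
    by_cases hx : (X, x) ∈ (fun z : Matrix (Fin n) (Fin p) ℝ × (Fin n → ℝ) =>
          (z.1, z.1.mulVec (fun j => θ j) + σ • z.2)) ⁻¹' B
    · rw [Set.indicator_of_mem hx, Set.indicator_of_mem (hmem.2 hx)]; rfl
    · rw [Set.indicator_of_notMem hx, Set.indicator_of_notMem (mt hmem.1 hx)]
  · ext x
    simp only [Set.indicator, likelihoodRatio]
    split_ifs <;> simp

lemma lintegral_likelihoodRatio_mul (PX : Measure (Matrix (Fin n) (Fin p) ℝ))
    [IsProbabilityMeasure PX] (σ : ℝ) (θ θ' : EuclideanSpace ℝ (Fin p)) :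
    ∫⁻ z, ENNReal.ofReal (likelihoodRatio σ θ z * likelihoodRatio σ θ' z)
        ∂PX.prod (whiteNoise n) =
      ∫⁻ X, ENNReal.ofReal (Real.exp (scaledMean σ θ X ⬝ᵥ scaledMean σ θ' X)) ∂PX := by
  have hm : Measurable fun z : Matrix (Fin n) (Fin p) ℝ × (Fin n → ℝ) =>
      ENNReal.ofReal (likelihoodRatio σ θ z * likelihoodRatio σ θ' z) :=
    ((measurable_likelihoodRatio σ θ).mul (measurable_likelihoodRatio σ θ')).ennreal_ofReal
  rw [lintegral_prod _ hm.aemeasurable]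
  simp only [likelihoodRatio, lintegral_shiftDensity_mul_shiftDensity]

lemma integrable_likelihoodRatio_mul (PX : Measure (Matrix (Fin n) (Fin p) ℝ))
    [IsProbabilityMeasure PX] (σ : ℝ) (θ θ' : EuclideanSpace ℝ (Fin p))
    (h : Integrable (fun X => Real.exp (scaledMean σ θ X ⬝ᵥ scaledMean σ θ' X)) PX) :
    Integrable (fun z => likelihoodRatio σ θ z * likelihoodRatio σ θ' z)
        (PX.prod (whiteNoise n)) ∧
    ∫ z, likelihoodRatio σ θ z * likelihoodRatio σ θ' z ∂PX.prod (whiteNoise n) =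
      ∫ X, Real.exp (scaledMean σ θ X ⬝ᵥ scaledMean σ θ' X) ∂PX := by
  have hm := ((measurable_likelihoodRatio (n := n) σ θ).mul (measurable_likelihoodRatio σ θ'))
  have h0 : ∀ z : Matrix (Fin n) (Fin p) ℝ × (Fin n → ℝ),
      0 ≤ likelihoodRatio σ θ z * likelihoodRatio σ θ' z := fun z =>
    mul_nonneg (likelihoodRatio_pos σ θ z).le (likelihoodRatio_pos σ θ' z).le
  have heq := lintegral_likelihoodRatio_mul PX σ θ θ'
  constructor
  · refine ⟨hm.aestronglyMeasurable, ?_⟩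
    rw [hasFiniteIntegral_iff_ofReal (ae_of_all _ h0), heq]
    exact (hasFiniteIntegral_iff_ofReal (ae_of_all _ fun _ => (Real.exp_pos _).le)).1 h.2
  · rw [integral_eq_lintegral_of_nonneg_ae (ae_of_all _ h0) hm.aestronglyMeasurable, heq,
      integral_eq_lintegral_of_nonneg_ae (ae_of_all _ fun _ => (Real.exp_pos _).le) h.1]

lemma integrable_likelihoodRatio (PX : Measure (Matrix (Fin n) (Fin p) ℝ))
    [IsProbabilityMeasure PX] (σ : ℝ) (θ : EuclideanSpace ℝ (Fin p)) :
    Integrable (likelihoodRatio σ θ) (PX.prod (whiteNoise n)) ∧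
    ∫ z, likelihoodRatio σ θ z ∂PX.prod (whiteNoise n) = 1 := by
  have h0 : scaledMean (n := n) σ (0 : EuclideanSpace ℝ (Fin p)) = 0 := by
    have : (fun _ => 0 : Fin p → ℝ) = 0 := rfl
    ext X; simp [scaledMean, this]
  -- The likelihood ratio at `0` is `1`, so the first moment is a special case of the mixed one.
  have := integrable_likelihoodRatio_mul PX σ θ 0 (by simp [h0])
  simpa only [likelihoodRatio_zero, mul_one, h0, Pi.zero_apply, dotProduct_zero, Real.exp_zero,
    integral_const, probReal_univ, smul_eq_mul] using this

/-- The second-moment (Ingster) lower bound with a uniform prior on a finite family. -/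
lemma le_minimaxRisk_of_second_moment (PX : Measure (Matrix (Fin n) (Fin p) ℝ))
    [IsProbabilityMeasure PX] {σ : ℝ} (hσ : 0 < σ) {s : ℕ} {τ ε : ℝ} (hε : 0 < ε)
    {F : Type*} [Fintype F] [Nonempty F] (θ : F → EuclideanSpace ℝ (Fin p))
    (hθ : ∀ f, θ f ∈ Alternative p s τ)
    (hint : ∀ f g, Integrable
      (fun X => Real.exp (scaledMean σ (θ f) X ⬝ᵥ scaledMean σ (θ g) X)) PX)
    (hle : ∑ f, ∑ g, ∫ X, Real.exp (scaledMean σ (θ f) X ⬝ᵥ scaledMean σ (θ g) X) ∂PX ≤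
      (1 + ε ^ 2) * (Fintype.card F : ℝ) ^ 2) :
    ENNReal.ofReal (1 - ε) ≤ minimaxRisk PX σ s τ := by
  refine le_iInf₂ fun Δ hΔ => ?_
  set Q := PX.prod (whiteNoise n) with hQ
  set N : ℝ := (Fintype.card F : ℝ) with hN
  have hNpos : 0 < N := by rw [hN]; exact_mod_cast Fintype.card_pos
  set L : Matrix (Fin n) (Fin p) ℝ × (Fin n → ℝ) → ℝ :=
    fun z => N⁻¹ * ∑ f, likelihoodRatio σ (θ f) z with hLdef
  set E := (fun z : Matrix (Fin n) (Fin p) ℝ × (Fin n → ℝ) => (z.1, σ • z.2)) ⁻¹'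
    {z | Δ z = 0} with hEdef
  have hB0 : MeasurableSet {z | Δ z = 0} := hΔ (measurableSet_singleton 0)
  have hB1 : MeasurableSet {z | Δ z = 1} := hΔ (measurableSet_singleton 1)
  have hE : MeasurableSet E := measurable_scale σ hB0
  have hEc : (fun z : Matrix (Fin n) (Fin p) ℝ × (Fin n → ℝ) => (z.1, σ • z.2)) ⁻¹'
      {z | Δ z = 1} = Eᶜ := by
    ext z
    simp only [hEdef, Set.mem_preimage, Set.mem_ofPred_eq, Set.mem_compl_iff]
    generalize Δ (z.1, σ • z.2) = d
    fin_cases d <;> simp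
  have hi := fun f => integrable_likelihoodRatio PX σ (θ f)
  have hii := fun f g => integrable_likelihoodRatio_mul PX σ (θ f) (θ g) (hint f g)
  have hLsq : (fun z => L z ^ 2) = fun z =>
      (N ^ 2)⁻¹ * ∑ f, ∑ g, likelihoodRatio σ (θ f) z * likelihoodRatio σ (θ g) z := by
    ext z
    rw [hLdef, mul_pow, sq (∑ f, _), Finset.sum_mul_sum, inv_pow]
  have hLi : Integrable L Q := (integrable_finsetSum _ fun f _ => (hi f).1).const_mul _
  have hL1 : ∫ z, L z ∂Q = 1 := by
    rw [hLdef, integral_const_mul, integral_finsetSum _ fun f _ => (hi f).1]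
    simp only [(hi _).2, Finset.sum_const, Finset.card_univ, nsmul_eq_mul, mul_one]
    exact inv_mul_cancel₀ hNpos.ne'
  have hL2i : Integrable (fun z => L z ^ 2) Q := by
    rw [hLsq]
    exact (integrable_finsetSum _ fun f _ => integrable_finsetSum _ fun g _ =>
      (hii f g).1).const_mul _
  have hL2 : ∫ z, L z ^ 2 ∂Q ≤ 1 + ε ^ 2 := by
    rw [hLsq, integral_const_mul, integral_finsetSum _ fun f _ => integrable_finsetSum _
      fun g _ => (hii f g).1]
    simp_rw [integral_finsetSum _ fun g _ => (hii _ g).1, (hii _ _).2]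
    rw [inv_mul_le_iff₀ (by positivity), mul_comm]
    exact hle
  have key := one_sub_le_of_integral_sq_le hε hLi hL2i hL1 hL2 hE
  have hjoint : ∀ f, jointLaw PX σ (θ f) {z | Δ z = 0} =
      ENNReal.ofReal (∫ z in E, likelihoodRatio σ (θ f) z ∂Q) := fun f => by
    rw [jointLaw_apply PX hσ (θ f) hB0, ofReal_integral_eq_lintegral_ofReal
      (hi f).1.integrableOn (ae_of_all _ fun z => (likelihoodRatio_pos _ _ z).le)]
  have hnull : jointLaw PX σ 0 {z | Δ z = 1} = ENNReal.ofReal (Q.real Eᶜ) := by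
    rw [jointLaw_apply PX hσ 0 hB1, hEc]
    simp [likelihoodRatio_zero, measureReal_def, hQ]
  set T := ⨆ θ ∈ Alternative p s τ, jointLaw PX σ θ {z | Δ z = 0} with hT
  have hsup : ENNReal.ofReal (∫ z in E, L z ∂Q) ≤ T := by
    by_cases hTtop : T = ⊤
    · simp [hTtop]
    rw [ENNReal.ofReal_le_iff_le_toReal hTtop, hLdef, integral_const_mul,
      integral_finsetSum _ fun f _ => (hi f).1.integrableOn, inv_mul_le_iff₀ hNpos]
    calc ∑ f, ∫ z in E, likelihoodRatio σ (θ f) z ∂Q ≤ ∑ _f : F, T.toReal := by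
          refine Finset.sum_le_sum fun f _ => ?_
          rw [← ENNReal.ofReal_le_iff_le_toReal hTtop, ← hjoint]
          exact le_iSup₂ (f := fun θ (_ : θ ∈ Alternative p s τ) =>
            jointLaw PX σ θ {z | Δ z = 0}) (θ f) (hθ f)
      _ = N * T.toReal := by simp [hN]
  calc ENNReal.ofReal (1 - ε) ≤ ENNReal.ofReal (Q.real Eᶜ + ∫ z in E, L z ∂Q) :=
        ENNReal.ofReal_le_ofReal key
    _ ≤ ENNReal.ofReal (Q.real Eᶜ) + ENNReal.ofReal (∫ z in E, L z ∂Q) :=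
        ENNReal.ofReal_add_le
    _ ≤ testRisk PX σ s τ Δ := by
        rw [testRisk, hnull]
        gcongr

/-! ### Exponential moments of products of subgaussian variables -/

/-- The exponential moment `E exp (g² / 8)` of a standard Gaussian `g`. -/
noncomputable def gaussianExpSq : ℝ := ∫ g, Real.exp (g ^ 2 / 8) ∂gaussianReal 0 1

lemma gaussianExpSq_nonneg : 0 ≤ gaussianExpSq := integral_nonneg fun _ => (Real.exp_pos _).le

lemma integrable_exp_sq_gaussianReal :
    Integrable (fun g => Real.exp (g ^ 2 / 8)) (gaussianReal 0 1) := by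
  rw [gaussianReal_of_var_ne_zero _ one_ne_zero,
    integrable_withDensity_iff (measurable_gaussianPDF _ _) (ae_of_all _ fun _ => ENNReal.ofReal_lt_top)]
  refine ((integrable_exp_neg_mul_sq (b := 3 / 8) (by norm_num)).const_mul
    (√(2 * Real.pi * (1 : NNReal)))⁻¹).congr (ae_of_all _ fun x => ?_)
  simp only [toReal_gaussianPDF]
  rw [gaussianPDFReal, mul_left_comm, ← Real.exp_add]
  congr 2
  simp only [NNReal.coe_one]; ring

variable {Ω : Type*} [MeasurableSpace Ω] {μ : Measure Ω}

/-- The square is linearised by an auxiliary standard Gaussian `g`: `exp(a x²) = E exp(√(2a) x g)`.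
After exchanging the integrals, the subgaussian bound leaves `exp(a c g²) ≤ exp(g²/8)`. -/
lemma integral_exp_mul_sq_le [IsProbabilityMeasure μ] {U : Ω → ℝ} {c : NNReal} {a : ℝ}
    (hU : HasSubgaussianMGF U c μ) (hUm : Measurable U) (ha : 0 ≤ a) (hac : 8 * (a * c) ≤ 1) :
    Integrable (fun ω => Real.exp (a * U ω ^ 2)) μ ∧
      ∫ ω, Real.exp (a * U ω ^ 2) ∂μ ≤ gaussianExpSq := by
  have hlin : ∀ x : ℝ, ENNReal.ofReal (Real.exp (a * x ^ 2)) =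
      ∫⁻ g, ENNReal.ofReal (Real.exp (√(2 * a) * x * g)) ∂gaussianReal 0 1 := by
    intro x
    rw [← ofReal_integral_eq_lintegral_ofReal (integrable_exp_mul_gaussianReal _)
      (ae_of_all _ fun _ => (Real.exp_pos _).le)]
    have := mgf_gaussianReal (p := gaussianReal 0 1) (X := id) Measure.map_id (√(2 * a) * x)
    simp only [mgf, id] at this
    rw [this, mul_pow, Real.sq_sqrt (by positivity)]
    congr 2
    simp only [NNReal.coe_one]; ring
  have hm : Measurable fun z : Ω × ℝ => ENNReal.ofReal (Real.exp (√(2 * a) * U z.1 * z.2)) :=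
    ((((hUm.comp measurable_fst).const_mul _).mul measurable_snd).exp).ennreal_ofReal
  have hle : ∫⁻ ω, ENNReal.ofReal (Real.exp (a * U ω ^ 2)) ∂μ ≤ ENNReal.ofReal gaussianExpSq := by
    simp_rw [hlin]
    rw [lintegral_lintegral_swap hm.aemeasurable, gaussianExpSq,
      ofReal_integral_eq_lintegral_ofReal integrable_exp_sq_gaussianReal
        (ae_of_all _ fun _ => (Real.exp_pos _).le)]
    refine lintegral_mono fun g => ?_
    have h1 : ∀ ω, √(2 * a) * U ω * g = (√(2 * a) * g) * U ω := fun ω => by ring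
    simp_rw [h1]
    rw [← ofReal_integral_eq_lintegral_ofReal (hU.integrable_exp_mul _)
      (ae_of_all _ fun _ => (Real.exp_pos _).le)]
    refine ENNReal.ofReal_le_ofReal ((hU.mgf_le _).trans (Real.exp_le_exp.2 ?_))
    rw [mul_pow, Real.sq_sqrt (by positivity)]
    nlinarith [mul_le_mul_of_nonneg_right hac (sq_nonneg g)]
  have hmE : Measurable fun ω => Real.exp (a * U ω ^ 2) := ((hUm.pow_const 2).const_mul a).exp
  constructor
  · refine ⟨hmE.aestronglyMeasurable, ?_⟩
    rw [hasFiniteIntegral_iff_ofReal (ae_of_all _ fun _ => (Real.exp_pos _).le)]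
    exact hle.trans_lt ENNReal.ofReal_lt_top
  · rw [integral_eq_lintegral_of_nonneg_ae (ae_of_all _ fun _ => (Real.exp_pos _).le)
      hmE.aestronglyMeasurable]
    exact ENNReal.toReal_le_of_le_ofReal gaussianExpSq_nonneg hle

lemma exp_le_one_add_add_sq_mul_exp_abs (x : ℝ) :
    Real.exp x ≤ 1 + x + x ^ 2 * Real.exp |x| := by
  have h := Complex.norm_exp_sub_sum_le_norm_mul_exp (x : ℂ) 2
  have h2 : Complex.exp x - ∑ m ∈ Finset.range 2, (x : ℂ) ^ m / m.factorial =
      ((Real.exp x - (1 + x) : ℝ) : ℂ) := by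
    simp [Finset.sum_range_succ]
  rw [h2, Complex.norm_real, Complex.norm_real, Real.norm_eq_abs, Real.norm_eq_abs, sq_abs] at h
  linarith [le_abs_self (Real.exp x - (1 + x))]

/-- Second-order Taylor expansion, keeping the mean exact because it will carry the overlap. Of the
factor `exp(2c|W|)`, one half absorbs `W²` and the other `exp(d|W|)`. -/
lemma mgf_le_of_integrable_exp_abs [IsProbabilityMeasure μ] {W : Ω → ℝ} {c K d : ℝ}
    (hW : Measurable W) (hc : 0 < c) (hint : Integrable (fun ω => Real.exp (2 * c * |W ω|)) μ)
    (hK : ∫ ω, Real.exp (2 * c * |W ω|) ∂μ ≤ K) (hd0 : 0 ≤ d) (hdc : d ≤ c) :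
    Integrable W μ ∧ Integrable (fun ω => Real.exp (d * W ω)) μ ∧
      mgf W μ d ≤ Real.exp (d * ∫ ω, W ω ∂μ + 2 * K / c ^ 2 * d ^ 2) := by
  have hWi : Integrable W μ := by
    refine (hint.const_mul (2 * c)⁻¹).mono' hW.aestronglyMeasurable (ae_of_all _ fun ω => ?_)
    rw [Real.norm_eq_abs, le_inv_mul_iff₀ (by positivity)]
    linarith [Real.add_one_le_exp (2 * c * |W ω|)]
  have hEi : Integrable (fun ω => Real.exp (d * W ω)) μ := by
    refine hint.mono' ((hW.const_mul d).exp).aestronglyMeasurable (ae_of_all _ fun ω => ?_)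
    rw [Real.norm_eq_abs, Real.abs_exp, Real.exp_le_exp]
    have h1 := le_abs_self (W ω)
    have h2 := abs_nonneg (W ω)
    nlinarith
  refine ⟨hWi, hEi, ?_⟩
  have hpt : ∀ ω, Real.exp (d * W ω) ≤
      1 + d * W ω + 2 / c ^ 2 * d ^ 2 * Real.exp (2 * c * |W ω|) := by
    intro ω
    refine (exp_le_one_add_add_sq_mul_exp_abs _).trans (add_le_add_right ?_ _)
    have h0 := abs_nonneg (W ω)
    have h1 : (W ω) ^ 2 ≤ 2 / c ^ 2 * Real.exp (c * |W ω|) := by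
      have := Real.quadratic_le_exp_of_nonneg (mul_nonneg hc.le h0)
      rw [div_mul_eq_mul_div, le_div_iff₀ (by positivity), ← sq_abs]
      nlinarith [mul_nonneg hc.le h0]
    have h2 : Real.exp |d * W ω| ≤ Real.exp (c * |W ω|) := by
      rw [Real.exp_le_exp, abs_mul, abs_of_nonneg hd0]
      gcongr
    calc (d * W ω) ^ 2 * Real.exp |d * W ω|
        ≤ (d ^ 2 * (2 / c ^ 2 * Real.exp (c * |W ω|))) * Real.exp (c * |W ω|) := by
          rw [mul_pow]; gcongr
      _ = 2 / c ^ 2 * d ^ 2 * Real.exp (2 * c * |W ω|) := by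
          rw [show 2 * c * |W ω| = c * |W ω| + c * |W ω| by ring, Real.exp_add]; ring
  have hle : mgf W μ d ≤ 1 + d * ∫ ω, W ω ∂μ + 2 / c ^ 2 * d ^ 2 * K := by
    refine (integral_mono hEi (by fun_prop) hpt).trans ?_
    rw [integral_add (by fun_prop) (by fun_prop), integral_add (by fun_prop) (by fun_prop),
      integral_const_mul, integral_const_mul]
    simp only [integral_const, probReal_univ, smul_eq_mul, one_mul]
    gcongr
  refine hle.trans ?_
  have := Real.add_one_le_exp (d * ∫ ω, W ω ∂μ + 2 * K / c ^ 2 * d ^ 2)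
  refine le_trans (le_of_eq ?_) this
  ring

lemma integrable_exp_abs_mul [IsProbabilityMeasure μ] {U V : Ω → ℝ} {c : NNReal} {a : ℝ}
    (hU : HasSubgaussianMGF U c μ) (hUm : Measurable U)
    (hV : HasSubgaussianMGF V c μ) (hVm : Measurable V) (ha : 0 ≤ a) (hac : 8 * (a * c) ≤ 1) :
    Integrable (fun ω => Real.exp (a * |U ω * V ω|)) μ ∧
      ∫ ω, Real.exp (a * |U ω * V ω|) ∂μ ≤ gaussianExpSq := by
  obtain ⟨hUi, hUK⟩ := integral_exp_mul_sq_le hU hUm ha hac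
  obtain ⟨hVi, hVK⟩ := integral_exp_mul_sq_le hV hVm ha hac
  have hpt : ∀ ω, Real.exp (a * |U ω * V ω|) ≤
      2⁻¹ * (Real.exp (a * U ω ^ 2) + Real.exp (a * V ω ^ 2)) := by
    intro ω
    have h1 : a * |U ω * V ω| ≤ a * U ω ^ 2 / 2 + a * V ω ^ 2 / 2 := by
      rw [abs_mul, ← sq_abs (U ω), ← sq_abs (V ω)]
      nlinarith [mul_nonneg ha (sq_nonneg (|U ω| - |V ω|))]
    have h2 : Real.exp (a * U ω ^ 2) = Real.exp (a * U ω ^ 2 / 2) ^ 2 := by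
      rw [← Real.exp_nat_mul]; congr 1; push_cast; ring
    have h3 : Real.exp (a * V ω ^ 2) = Real.exp (a * V ω ^ 2 / 2) ^ 2 := by
      rw [← Real.exp_nat_mul]; congr 1; push_cast; ring
    refine (Real.exp_le_exp.2 h1).trans ?_
    rw [Real.exp_add, h2, h3]
    nlinarith [sq_nonneg (Real.exp (a * U ω ^ 2 / 2) - Real.exp (a * V ω ^ 2 / 2))]
  have hi : Integrable (fun ω => 2⁻¹ * (Real.exp (a * U ω ^ 2) + Real.exp (a * V ω ^ 2))) μ := by
    fun_prop
  have hint : Integrable (fun ω => Real.exp (a * |U ω * V ω|)) μ :=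
    hi.mono' (((measurable_norm.comp (hUm.mul hVm)).const_mul a).exp).aestronglyMeasurable
      (ae_of_all _ fun ω => by rw [Real.norm_eq_abs, Real.abs_exp]; exact hpt ω)
  refine ⟨hint, (integral_mono hint hi hpt).trans ?_⟩
  rw [integral_const_mul, integral_add hUi hVi]
  linarith

/-! ### The Gram matrix of the design -/

variable {n p : ℕ}

lemma measurable_rowVec (i : Fin n) : Measurable (rowVec (p := p) i) :=
  (WithLp.measurable_toLp 2 (Fin p → ℝ)).comp
    (measurable_pi_apply (X := fun _ : Fin n => Fin p → ℝ) i)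

lemma inner_rowVec (i : Fin n) (X : Matrix (Fin n) (Fin p) ℝ) (v : EuclideanSpace ℝ (Fin p)) :
    inner ℝ (rowVec i X) v = ∑ j, X i j * v j := by
  simp [rowVec, PiLp.inner_apply, mul_comm]

lemma measurable_inner_rowVec (i : Fin n) (v : EuclideanSpace ℝ (Fin p)) :
    Measurable fun X : Matrix (Fin n) (Fin p) ℝ => (inner ℝ (rowVec i X) v : ℝ) :=
  (measurable_rowVec i).inner_const

/-- The bilinear form of the Gram matrix of an isotropic design has mean `n ⟨u, v⟩`. -/
lemma integral_sum_inner_rowVec_mul {PX : Measure (Matrix (Fin n) (Fin p) ℝ)} (hn : 1 ≤ n)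
    (hiso : IsIsotropic PX) (u v : EuclideanSpace ℝ (Fin p)) :
    ∫ X, ∑ i, (inner ℝ (rowVec i X) u : ℝ) * inner ℝ (rowVec i X) v ∂PX = n * inner ℝ u v := by
  have hn0 : (n : ℝ) ≠ 0 := by positivity
  have hX : ∀ X : Matrix (Fin n) (Fin p) ℝ,
      ∑ i, (inner ℝ (rowVec i X) u : ℝ) * inner ℝ (rowVec i X) v =
        ∑ j, ∑ k, (n * u j * v k) * ((X.transpose * X) j k / n) := by
    intro X
    simp_rw [inner_rowVec, Finset.sum_mul_sum, Matrix.mul_apply, Matrix.transpose_apply,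
      Finset.sum_div, Finset.mul_sum]
    rw [Finset.sum_comm]
    refine Finset.sum_congr rfl fun j _ => ?_
    rw [Finset.sum_comm]
    refine Finset.sum_congr rfl fun k _ => Finset.sum_congr rfl fun i _ => ?_
    field_simp
  simp_rw [hX]
  rw [integral_finsetSum _ fun j _ => integrable_finsetSum _ fun k _ => ((hiso j k).1).const_mul _]
  simp_rw [integral_finsetSum _ fun k _ => ((hiso _ k).1).const_mul _, integral_const_mul,
    (hiso _ _).2, Matrix.one_apply]
  simp [PiLp.inner_apply, Finset.mul_sum, mul_comm, -mul_eq_mul_left_iff]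
  exact Finset.sum_congr rfl fun _ _ => by ring

/-- The exponential moment bound for the bilinear form of the Gram matrix. -/
lemma integral_exp_sum_inner_rowVec_mul_le {PX : Measure (Matrix (Fin n) (Fin p) ℝ)}
    [IsProbabilityMeasure PX] (hn : 1 ≤ n) {b : ℝ} (hb : 0 < b) (hiso : IsIsotropic PX)
    (hrow : HasIndepSubgaussianRows b PX) {u v : EuclideanSpace ℝ (Fin p)} (hu : ‖u‖ = 1)
    (hv : ‖v‖ = 1) {d : ℝ} (hd0 : 0 ≤ d) (hd : d ≤ 1 / (16 * b ^ 2)) :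
    Integrable (fun X => Real.exp
      (d * ∑ i, (inner ℝ (rowVec i X) u : ℝ) * inner ℝ (rowVec i X) v)) PX ∧
    ∫ X, Real.exp (d * ∑ i, (inner ℝ (rowVec i X) u : ℝ) * inner ℝ (rowVec i X) v) ∂PX ≤
      Real.exp (d * (n * inner ℝ u v) +
        n * (2 * gaussianExpSq / (1 / (16 * b ^ 2)) ^ 2 * d ^ 2)) := by
  -- Chosen so that `8 · 2c · b² = 1`, the extreme case allowed by `integrable_exp_abs_mul` at rate
  -- `2c`.
  set c : ℝ := 1 / (16 * b ^ 2) with hc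
  have hcpos : 0 < c := by positivity
  set W : Fin n → Matrix (Fin n) (Fin p) ℝ → ℝ :=
    fun i X => (inner ℝ (rowVec i X) u : ℝ) * inner ℝ (rowVec i X) v with hWdef
  have hWm : ∀ i, Measurable (W i) := fun i =>
    (measurable_inner_rowVec i u).mul (measurable_inner_rowVec i v)
  have hac : 8 * (2 * c * (Real.toNNReal (b ^ 2) : ℝ)) ≤ 1 := by
    rw [Real.coe_toNNReal _ (sq_nonneg b), hc]
    apply le_of_eq; field_simp; norm_num
  have hexp := fun i => integrable_exp_abs_mul (hrow.2 i u hu) (measurable_inner_rowVec i u)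
    (hrow.2 i v hv) (measurable_inner_rowVec i v) (by positivity : 0 ≤ 2 * c) hac
  have hmgf := fun i => mgf_le_of_integrable_exp_abs (hWm i) hcpos (hexp i).1 (hexp i).2 hd0 hd
  have hind : iIndepFun W PX :=
    hrow.1.comp (fun _ x => (inner ℝ x u : ℝ) * inner ℝ x v) fun _ => by fun_prop
  have hsum : ∀ X, d * ∑ i, (inner ℝ (rowVec i X) u : ℝ) * inner ℝ (rowVec i X) v =
      d * (∑ i, W i) X := fun X => by simp [hWdef]
  simp_rw [hsum]
  refine ⟨hind.integrable_exp_mul_sum hWm fun i _ => (hmgf i).2.1, ?_⟩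
  change mgf (∑ i, W i) PX d ≤ _
  rw [hind.mgf_sum hWm]
  calc ∏ i, mgf (W i) PX d
      ≤ ∏ i, Real.exp (d * ∫ X, W i X ∂PX + 2 * gaussianExpSq / c ^ 2 * d ^ 2) :=
        Finset.prod_le_prod (fun i _ => mgf_nonneg) fun i _ => (hmgf i).2.2
    _ = Real.exp (d * (n * inner ℝ u v) + n * (2 * gaussianExpSq / c ^ 2 * d ^ 2)) := by
        -- Isotropy says nothing about a single row; only the sum of the means over all rows is
        -- known.
        rw [← Real.exp_sum, Finset.sum_add_distrib, ← Finset.mul_sum,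
          ← integral_finsetSum _ fun i _ => (hmgf i).1, integral_sum_inner_rowVec_mul hn hiso]
        simp

/-! ### The block prior and the law of its overlaps -/

/-- The real sign encoded by a Boolean. -/
def boolSign (e : Bool) : ℝ := if e then 1 else -1

/-- The overlap of two signed basis vectors. -/
def signedOverlap {κ : Type*} [DecidableEq κ] (x y : κ × Bool) : ℝ :=
  if x.1 = y.1 then boolSign x.2 * boolSign y.2 else 0

lemma signedOverlap_self {κ : Type*} [DecidableEq κ] (x : κ × Bool) : signedOverlap x x = 1 := by
  rcases x with ⟨j, e⟩
  cases e <;> simp [signedOverlap, boolSign]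

/-- The unit vector with one entry `± 1 / √s` in each of `s` disjoint blocks of size `m`. -/
noncomputable def blockVec {s m p : ℕ} (ι : Fin s × Fin m → Fin p) (f : Fin s → Fin m × Bool) :
    EuclideanSpace ℝ (Fin p) :=
  (√s)⁻¹ • ∑ b, boolSign (f b).2 • EuclideanSpace.single (ι (b, (f b).1)) (1 : ℝ)

variable {s m p : ℕ} {ι : Fin s × Fin m → Fin p}

lemma inner_blockVec (hι : Function.Injective ι) (f g : Fin s → Fin m × Bool) :
    (inner ℝ (blockVec ι f) (blockVec ι g) : ℝ) =
      (s : ℝ)⁻¹ * ∑ b, signedOverlap (f b) (g b) := by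
  have hs : (√(s : ℝ))⁻¹ * (√(s : ℝ))⁻¹ = (s : ℝ)⁻¹ := by
    rw [← mul_inv, Real.mul_self_sqrt (Nat.cast_nonneg s)]
  simp only [blockVec, inner_smul_left, inner_smul_right, sum_inner, inner_sum,
    EuclideanSpace.inner_single_left, PiLp.single_apply, map_one, one_mul,
    hι.eq_iff, Prod.mk.injEq, RCLike.conj_to_real]
  rw [← hs, mul_assoc]
  congr 1
  rw [Finset.mul_sum]
  refine Finset.sum_congr rfl fun b _ => ?_
  rw [Finset.sum_eq_single b]
  · simp only [signedOverlap, true_and, mul_ite, mul_one, mul_zero]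
    split_ifs
    · ring
    · rfl
  · intro b' _ hb
    simp [hb]
  · simp

lemma norm_blockVec (hι : Function.Injective ι) (hs : 1 ≤ s) (f : Fin s → Fin m × Bool) :
    ‖blockVec ι f‖ = 1 := by
  have h : ‖blockVec ι f‖ ^ 2 = 1 := by
    rw [← real_inner_self_eq_norm_sq, inner_blockVec hι]
    simp only [signedOverlap_self, Finset.sum_const, Finset.card_univ, Fintype.card_fin,
      nsmul_eq_mul, mul_one]
    exact inv_mul_cancel₀ (by positivity)
  exact (pow_eq_one_iff_of_nonneg (norm_nonneg _) two_ne_zero).1 h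

lemma l0Norm_smul_blockVec_le (τ : ℝ) (f : Fin s → Fin m × Bool) :
    l0Norm (τ • blockVec ι f) ≤ s := by
  calc l0Norm (τ • blockVec ι f) ≤ (Finset.univ.image fun b => ι (b, (f b).1)).card := by
        refine Finset.card_le_card fun k hk => ?_
        by_contra hk'
        simp only [Finset.mem_image, Finset.mem_univ, true_and, not_exists] at hk'
        refine (Finset.mem_filter.1 hk).2 ?_
        simp only [blockVec, PiLp.smul_apply, WithLp.ofLp_sum, Finset.sum_apply,
          PiLp.single_apply, smul_eq_mul]
        rw [Finset.sum_eq_zero, mul_zero, mul_zero]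
        intro b _
        simp [Ne.symm (hk' b)]
    _ ≤ s := Finset.card_image_le.trans (by simp)

/-- Independence of the blocks, in counting form: the double sum over pairs of prior vectors
factorises. -/
lemma sum_sum_prod_eq_pow {κ : Type*} [Fintype κ] (F : κ → κ → ℝ) :
    ∑ f : Fin s → κ, ∑ g : Fin s → κ, ∏ b, F (f b) (g b) = (∑ x, ∑ y, F x y) ^ s := by
  rw [← Fintype.sum_prod_type', ← Fintype.sum_prod_type' (f := F), Fintype.sum_pow]
  exact (Equiv.sum_comp (Equiv.arrowProdEquivProdArrow (Fin s) (fun _ => κ) (fun _ => κ))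
    fun z : (Fin s → κ) × (Fin s → κ) => ∏ b, F (z.1 b) (z.2 b)).symm

/-- Within a block the positions agree with probability `1/m`, and then the product of the signs is
uniform on `±1`, which gives `cosh t`. The factor `(2m)²` counts the pairs. -/
lemma sum_sum_exp_signedOverlap (hm : 1 ≤ m) (t : ℝ) :
    ∑ x : Fin m × Bool, ∑ y : Fin m × Bool, Real.exp (t * signedOverlap x y) =
      (2 * m) ^ 2 * (1 + (Real.cosh t - 1) / m) := by
  have hm0 : (m : ℝ) ≠ 0 := by positivity
  have h : ∀ j k : Fin m, ∑ e : Bool, ∑ e' : Bool,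
      Real.exp (t * signedOverlap (j, e) (k, e')) =
        4 + if j = k then 4 * (Real.cosh t - 1) else 0 := by
    intro j k
    by_cases hjk : j = k
    · simp [signedOverlap, boolSign, hjk, Real.cosh_eq]; ring
    · simp [signedOverlap, hjk]; norm_num
  have h2 : ∑ x : Fin m × Bool, ∑ y : Fin m × Bool, Real.exp (t * signedOverlap x y) =
      ∑ j : Fin m, ∑ k : Fin m, ∑ e : Bool, ∑ e' : Bool,
        Real.exp (t * signedOverlap (j, e) (k, e')) := by
    simp_rw [Fintype.sum_prod_type]
    exact Finset.sum_congr rfl fun j _ => Finset.sum_comm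
  rw [h2]
  simp_rw [h, Finset.sum_add_distrib, Finset.sum_ite_eq]
  simp
  field_simp
  ring

/-- The Laplace transform of the overlap of two independent vectors from the block prior. -/
lemma sum_sum_exp_inner_blockVec_le (hι : Function.Injective ι) (hs : 1 ≤ s) (hm : 1 ≤ m)
    (t : ℝ) :
    ∑ f : Fin s → Fin m × Bool, ∑ g : Fin s → Fin m × Bool,
        Real.exp (t * s * inner ℝ (blockVec ι f) (blockVec ι g)) ≤
      (Fintype.card (Fin s → Fin m × Bool) : ℝ) ^ 2 *
        Real.exp (s * ((Real.cosh t - 1) / m)) := by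
  have hs0 : (s : ℝ) ≠ 0 := by positivity
  have h : ∀ f g : Fin s → Fin m × Bool,
      Real.exp (t * s * inner ℝ (blockVec ι f) (blockVec ι g)) =
        ∏ b, Real.exp (t * signedOverlap (f b) (g b)) := by
    intro f g
    rw [inner_blockVec hι, ← Real.exp_sum, ← Finset.mul_sum]
    congr 1
    field_simp
  simp_rw [h]
  rw [sum_sum_prod_eq_pow fun x y : Fin m × Bool => Real.exp (t * signedOverlap x y),
    sum_sum_exp_signedOverlap hm, mul_pow, Real.exp_nat_mul]
  have hcosh : 0 ≤ (Real.cosh t - 1) / m :=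
    div_nonneg (sub_nonneg.2 (Real.one_le_cosh t)) (Nat.cast_nonneg m)
  have hcard : (Fintype.card (Fin s → Fin m × Bool) : ℝ) ^ 2 = (((2 : ℝ) * m) ^ 2) ^ s := by
    simp only [Fintype.card_fun, Fintype.card_prod, Fintype.card_fin, Fintype.card_bool]
    push_cast
    rw [mul_comm (m : ℝ), ← pow_mul, ← pow_mul, mul_comm s]
  rw [hcard]
  gcongr
  linarith [Real.add_one_le_exp ((Real.cosh t - 1) / m)]

/-! ### Calibration of the rate -/

/-- Two regimes. If `s² ≤ p`, the logarithmic bound on `t` controls `exp t`. If `s² > p`, then `t ≤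
1` by the bound through `√p / s`, and `cosh t - 1` is of order `t²`. -/
lemma mul_cosh_sub_one_div_le {A t : ℝ} (hs : 1 ≤ s) (hsp : s ≤ p) (hA0 : 0 ≤ A) (hA1 : A ≤ 1)
    (ht0 : 0 ≤ t) (ht1 : t ≤ A ^ 2 * Real.log (2 + p / (s : ℝ) ^ 2))
    (ht2 : t ≤ A ^ 2 * (√p / s)) :
    s * ((Real.cosh t - 1) / (p / s : ℕ)) ≤ 4 * A ^ 2 := by
  have hs0 : (0 : ℝ) < s := by positivity
  have hp0 : (0 : ℝ) < p := by exact_mod_cast (by omega : 0 < p)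
  have hA2 : A ^ 2 ≤ 1 := pow_le_one₀ hA0 hA1
  have hm1 : 1 ≤ p / s := (Nat.one_le_div_iff (by omega)).2 hsp
  have hm : (p : ℝ) ≤ 2 * s * (p / s : ℕ) := by
    have h1 : p < s * (p / s + 1) := Nat.lt_mul_div_succ p (by omega)
    have h2 : p ≤ 2 * s * (p / s) := by nlinarith
    exact_mod_cast h2
  have hm0 : (0 : ℝ) < (p / s : ℕ) := by exact_mod_cast hm1
  have hcosh : 0 ≤ Real.cosh t - 1 := sub_nonneg.2 (Real.one_le_cosh t)
  -- Rounding `p / s` down costs a factor `2`, which turns the constant `2` into `4`.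
  suffices h : Real.cosh t - 1 ≤ 2 * A ^ 2 * (p / (s : ℝ) ^ 2) by
    rw [mul_div_assoc', div_le_iff₀ hm0]
    calc s * (Real.cosh t - 1) ≤ s * (2 * A ^ 2 * (p / (s : ℝ) ^ 2)) := by gcongr
      _ = 2 * A ^ 2 * (p / s) := by field_simp
      _ ≤ 2 * A ^ 2 * (2 * (p / s : ℕ)) := by
          gcongr
          rw [div_le_iff₀ hs0]
          linarith
      _ = 4 * A ^ 2 * (p / s : ℕ) := by ring
  rcases le_or_gt ((s : ℝ) ^ 2) p with hsq | hsq
  · set u : ℝ := p / (s : ℝ) ^ 2 with hu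
    have hu1 : 1 ≤ u := by rw [hu, one_le_div (by positivity)]; exact hsq
    have h1 : Real.cosh t ≤ Real.exp t := by
      rw [Real.cosh_eq]
      linarith [Real.exp_le_exp.2 (by linarith : -t ≤ t)]
    have h2 : Real.exp t ≤ (1 + (1 + u)) ^ (A ^ 2) := by
      rw [Real.rpow_def_of_pos (by linarith), Real.exp_le_exp]
      calc t ≤ A ^ 2 * Real.log (2 + u) := ht1
        _ = Real.log (1 + (1 + u)) * A ^ 2 := by rw [mul_comm]; ring_nf
    -- Bernoulli with exponent `A² ≤ 1` gives `1 + A²(1 + u)`, and `1 + u ≤ 2u` since `u ≥ 1`.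
    have h3 := rpow_one_add_le_one_add_mul_self (by linarith : -1 ≤ 1 + u) (sq_nonneg A) hA2
    nlinarith [sq_nonneg A]
  · have hsqrt : √p ≤ s := Real.sqrt_le_iff.2 ⟨hs0.le, hsq.le⟩
    have h1 : √p / s ≤ 1 := (div_le_one hs0).2 hsqrt
    have hq0 : 0 ≤ √p / s := by positivity
    have hqs : (√p / s) ^ 2 = p / (s : ℝ) ^ 2 := by
      rw [div_pow, Real.sq_sqrt hp0.le]
    have ht2' : t ^ 2 ≤ A ^ 2 * (p / (s : ℝ) ^ 2) := by
      rw [← hqs]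
      calc t ^ 2 ≤ (A ^ 2 * (√p / s)) ^ 2 := by gcongr
        _ = A ^ 2 * (A ^ 2 * (√p / s) ^ 2) := by ring
        _ ≤ A ^ 2 * (1 * (√p / s) ^ 2) := by gcongr
        _ = _ := by ring
    have ht1' : t ^ 2 ≤ 1 := by
      rw [← hqs] at ht2'
      nlinarith [pow_le_one₀ hq0 h1 (n := 2), sq_nonneg (√p / s)]
    have h2 := Real.cosh_le_exp_half_sq t
    have h3 := Real.abs_exp_sub_one_le (x := t ^ 2 / 2) (by
      rw [abs_of_nonneg (by positivity)]; linarith)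
    rw [abs_of_nonneg (by positivity : 0 ≤ t ^ 2 / 2)] at h3
    have h4 := le_abs_self (Real.exp (t ^ 2 / 2) - 1)
    have h5 : 0 ≤ A ^ 2 * (p / (s : ℝ) ^ 2) := by positivity
    linarith

lemma scaledMean_smul_dotProduct {n p : ℕ} (σ τ : ℝ) (u v : EuclideanSpace ℝ (Fin p))
    (X : Matrix (Fin n) (Fin p) ℝ) :
    scaledMean σ (τ • u) X ⬝ᵥ scaledMean σ (τ • v) X =
      (τ / σ) ^ 2 * ∑ i, (inner ℝ (rowVec i X) u : ℝ) * inner ℝ (rowVec i X) v := by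
  have h : ∀ (w : EuclideanSpace ℝ (Fin p)) (i : Fin n),
      scaledMean σ (τ • w) X i = τ / σ * inner ℝ (rowVec i X) w := by
    intro w i
    rw [inner_rowVec, Finset.mul_sum]
    simp only [scaledMean, Pi.smul_apply, Matrix.mulVec, dotProduct, smul_eq_mul, PiLp.smul_apply,
      Finset.mul_sum]
    exact Finset.sum_congr rfl fun j _ => by ring
  simp only [dotProduct, h, Finset.mul_sum]
  exact Finset.sum_congr rfl fun i _ => by ring

lemma min_rate_bounds {n p s : ℕ} (hn : 1 ≤ n) {M : ℝ}
    (hM : M = min (√((s : ℝ) * Real.log (2 + (p : ℝ) / (s : ℝ) ^ 2) / (n : ℝ)))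
      (min ((n : ℝ) ^ (-(1 / 4) : ℝ)) ((p : ℝ) ^ (1 / 4 : ℝ) / √(n : ℝ)))) :
    0 ≤ M ∧ n * M ^ 2 ≤ s * Real.log (2 + (p : ℝ) / (s : ℝ) ^ 2) ∧ n * M ^ 4 ≤ 1 ∧
      n * M ^ 2 ≤ √p := by
  have hn0 : (0 : ℝ) < n := by positivity
  have hlog : 0 ≤ Real.log (2 + (p : ℝ) / (s : ℝ) ^ 2) :=
    Real.log_nonneg (by have : 0 ≤ (p : ℝ) / (s : ℝ) ^ 2 := by positivity
                        linarith)
  have hM0 : 0 ≤ M := by rw [hM]; positivity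
  have h1 : M ≤ √((s : ℝ) * Real.log (2 + (p : ℝ) / (s : ℝ) ^ 2) / (n : ℝ)) :=
    hM.trans_le (min_le_left _ _)
  have h2 : M ≤ (n : ℝ) ^ (-(1 / 4) : ℝ) :=
    hM.trans_le ((min_le_right _ _).trans (min_le_left _ _))
  have h3 : M ≤ (p : ℝ) ^ (1 / 4 : ℝ) / √(n : ℝ) :=
    hM.trans_le ((min_le_right _ _).trans (min_le_right _ _))
  refine ⟨hM0, ?_, ?_, ?_⟩
  · have := pow_le_pow_left₀ hM0 h1 2
    rw [Real.sq_sqrt (by positivity), le_div_iff₀ hn0] at this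
    linarith
  · have := pow_le_pow_left₀ hM0 h2 4
    rw [← Real.rpow_mul_natCast hn0.le, show (-(1 / 4) : ℝ) * (4 : ℕ) = -1 by norm_num,
      Real.rpow_neg_one] at this
    calc n * M ^ 4 ≤ n * (n : ℝ)⁻¹ := by gcongr
      _ = 1 := mul_inv_cancel₀ hn0.ne'
  · have := pow_le_pow_left₀ hM0 h3 2
    rw [div_pow, Real.sq_sqrt hn0.le, ← Real.rpow_mul_natCast (Nat.cast_nonneg p),
      show (1 / 4 : ℝ) * (2 : ℕ) = 1 / 2 by norm_num, ← Real.sqrt_eq_rpow,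
      le_div_iff₀ hn0] at this
    linarith

end SparseTesting

/-! ### Assembly -/

open SparseTesting in
theorem theorem4 (ε : ℝ) (hε0 : 0 < ε) (hε1 : ε < 1) (σX : ℝ) (hσX : 0 < σX) :
    ∃ a : ℝ, 0 < a ∧
      ∀ (n p s : ℕ), 1 ≤ n → 1 ≤ s → s ≤ p →
      ∀ σ : ℝ, 0 < σ →
      ∀ PX : Measure (Matrix (Fin n) (Fin p) ℝ), IsProbabilityMeasure PX →
        SparseTesting.IsIsotropic PX →
        SparseTesting.HasIndepSubgaussianRows σX PX →
      ∀ A : ℝ, 0 < A → A < a →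
        ENNReal.ofReal (1 - ε) ≤
          SparseTesting.minimaxRisk PX σ s
            (A * σ *
              min (Real.sqrt ((s : ℝ) * Real.log (2 + (p : ℝ) / (s : ℝ) ^ 2) / (n : ℝ)))
                (min ((n : ℝ) ^ (-(1 / 4) : ℝ))
                  ((p : ℝ) ^ (1 / 4 : ℝ) / Real.sqrt (n : ℝ)))) := by
  set c : ℝ := 1 / (16 * σX ^ 2) with hc
  set C : ℝ := 2 * gaussianExpSq / c ^ 2 with hC
  have hc0 : 0 < c := by positivity
  have hC0 : 0 ≤ C := by have := gaussianExpSq_nonneg; positivity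
  have hlogε : 0 < Real.log (1 + ε ^ 2) := Real.log_pos (by nlinarith)
  -- The bound `√c` keeps `δ = A²M²` in the range of the exponential moment estimate, as `M ≤ 1`.
  -- The last term fits the total exponent `CA² + 4A²` under `log(1 + ε²)`.
  refine ⟨min 1 (min (√c) (√(Real.log (1 + ε ^ 2) / (C + 4)))), by positivity, ?_⟩
  intro n p s hn hs hsp σ hσ PX hPX hiso hrow A hA hAa
  obtain ⟨hA1, hAa⟩ := lt_min_iff.1 hAa
  obtain ⟨hAc, hAε⟩ := lt_min_iff.1 hAa
  have hAc : A ^ 2 ≤ c := (Real.le_sqrt' hA).1 hAc.le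
  have hAε : A ^ 2 * (C + 4) ≤ Real.log (1 + ε ^ 2) := by
    rw [← le_div_iff₀ (by positivity)]
    exact (Real.le_sqrt' hA).1 hAε.le
  generalize hM : min (Real.sqrt ((s : ℝ) * Real.log (2 + (p : ℝ) / (s : ℝ) ^ 2) / (n : ℝ)))
    (min ((n : ℝ) ^ (-(1 / 4) : ℝ)) ((p : ℝ) ^ (1 / 4 : ℝ) / Real.sqrt (n : ℝ))) = M
  obtain ⟨hM0, hMs, hM4, hMp⟩ := min_rate_bounds hn hM.symm
  have hs0 : (0 : ℝ) < s := by positivity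
  have hn0 : (1 : ℝ) ≤ n := by exact_mod_cast hn
  have hM1 : M ≤ 1 := by
    refine (pow_le_one_iff_of_nonneg hM0 four_ne_zero).1 ?_
    nlinarith [pow_nonneg hM0 4]
  have hA2 : A ^ 2 ≤ 1 := pow_le_one₀ hA.le hA1.le
  have hm : 1 ≤ p / s := (Nat.one_le_div_iff (by omega)).2 hsp
  -- The blocks fill the first `s⌊p/s⌋` coordinates; the remaining ones stay zero.
  set ι : Fin s × Fin (p / s) → Fin p :=
    fun x => Fin.castLE (Nat.mul_div_le p s) (finProdFinEquiv x)
  have hι : Function.Injective ι :=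
    (Fin.castLE_injective _).comp finProdFinEquiv.injective
  have : Nonempty (Fin s → Fin (p / s) × Bool) := ⟨fun _ => (⟨0, hm⟩, true)⟩
  have hδ : (A * σ * M / σ) ^ 2 = A ^ 2 * M ^ 2 := by field_simp
  have hδc : A ^ 2 * M ^ 2 ≤ c :=
    (mul_le_of_le_one_right (sq_nonneg A) (pow_le_one₀ hM0 hM1)).trans hAc
  set t : ℝ := n * (A ^ 2 * M ^ 2) / s with ht
  have ht0 : 0 ≤ t := by positivity
  have hexp := fun f g : Fin s → Fin (p / s) × Bool =>
    integral_exp_sum_inner_rowVec_mul_le hn hσX hiso hrow (norm_blockVec hι hs f)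
      (norm_blockVec hι hs g) (by positivity : 0 ≤ A ^ 2 * M ^ 2) hδc
  refine le_minimaxRisk_of_second_moment PX hσ hε0
    (fun f : Fin s → Fin (p / s) × Bool => (A * σ * M) • blockVec ι f) ?_ ?_ ?_
  · intro f
    refine ⟨l0Norm_smul_blockVec_le _ _, ?_⟩
    rw [norm_smul, norm_blockVec hι hs, mul_one]
    exact le_abs_self _
  · intro f g
    simp only [scaledMean_smul_dotProduct, hδ]
    exact (hexp f g).1
  · simp only [scaledMean_smul_dotProduct, hδ]
    have hoverlap := sum_sum_exp_inner_blockVec_le hι hs hm t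
    -- The only place where the `n^(-1/4)` term is needed at full strength, as `nM⁴ ≤ 1`.
    have hrem : n * (C * (A ^ 2 * M ^ 2) ^ 2) ≤ C * A ^ 2 := by
      calc n * (C * (A ^ 2 * M ^ 2) ^ 2) = C * A ^ 2 * (A ^ 2 * (n * M ^ 4)) := by ring
        _ ≤ C * A ^ 2 * (1 * 1) := by gcongr
        _ = C * A ^ 2 := by ring
    have hcosh := mul_cosh_sub_one_div_le hs hsp hA.le hA1.le ht0
      (by rw [ht, div_le_iff₀ hs0]; nlinarith [mul_le_mul_of_nonneg_left hMs (sq_nonneg A)])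
      (by rw [ht, mul_div_assoc']; gcongr ?_ / _
          nlinarith [mul_le_mul_of_nonneg_left hMp (sq_nonneg A)])
    have hts : t * s = n * (A ^ 2 * M ^ 2) := by rw [ht]; field_simp
    set N : ℝ := (Fintype.card (Fin s → Fin (p / s) × Bool) : ℝ)
    calc _ ≤ ∑ f : Fin s → Fin (p / s) × Bool, ∑ g : Fin s → Fin (p / s) × Bool,
          Real.exp (t * s * inner ℝ (blockVec ι f) (blockVec ι g)) * Real.exp (C * A ^ 2) := by
          refine Finset.sum_le_sum fun f _ => Finset.sum_le_sum fun g _ =>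
            (hexp f g).2.trans ?_
          rw [← Real.exp_add, Real.exp_le_exp, hts]
          linarith
      _ = (∑ f : Fin s → Fin (p / s) × Bool, ∑ g : Fin s → Fin (p / s) × Bool,
          Real.exp (t * s * inner ℝ (blockVec ι f) (blockVec ι g))) * Real.exp (C * A ^ 2) := by
          simp_rw [Finset.sum_mul]
      _ ≤ (N ^ 2 * Real.exp (4 * A ^ 2)) * Real.exp (C * A ^ 2) := by
          gcongr
          refine hoverlap.trans ?_
          gcongr
      _ = Real.exp (A ^ 2 * (C + 4)) * N ^ 2 := by
          rw [mul_assoc, ← Real.exp_add, mul_comm]; congr 2; ring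
      _ ≤ (1 + ε ^ 2) * N ^ 2 := by
          gcongr
          exact (Real.le_log_iff_exp_le (by positivity)).1 hAε
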